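/- Let $n=p_1^{\alpha_1}\cdots p_k^{\alpha_k}$, where $\alpha_i\ge 1$ and the distinct primes $p_i$ satisfy $p_i\equiv 1\pmod 4$ for all $i=1,\ldots,k$. Let $G_n$ be the Paley-type graph of order $n$: its vertex set is $\mathbb{Z}_n=\mathbb{Z}/n\mathbb{Z}$, and two distinct vertices $a,b$ are joined by an edge if $a-b$ is the square of a unit of $\mathbb{Z}_n$. The clique number of a graph is the order of a clique of maximum size contained in it. Then: 1. if $p_i=5$ for some $i\in\{1,\ldots,k\}$, then the clique number of $G_n$ is $2$; 2. if $p_i\in\{13,17\}$ for some $i\in\{1,\ldots,k\}$ and $5\nmid n$, then the clique number of $G_n$ is $3$. -/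

import Mathlib

/-- The Paley-type graph of order `n`: its vertex set is `ZMod n`, and two distinct vertices `a`, `b`
are joined by an edge if `a - b` is the square of a unit of `ZMod n`. This relation is symmetric for
the moduli `n` of interest, see `paleyTypeGraph_adj_iff`. -/
def paleyTypeGraph (n : ℕ) : SimpleGraph (ZMod n) :=
  SimpleGraph.fromRel fun a b => ∃ u : (ZMod n)ˣ, a - b = (u : ZMod n) ^ 2

theorem isSquare_neg_one_of_prime_pow {q : ℕ} (hq : q.Prime) (h4 : q % 4 = 1) (m : ℕ) :
    IsSquare (-1 : ZMod (q ^ m)) := by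
  haveI := Fact.mk hq
  rcases m with _ | m
  · exact ⟨0, by rw [pow_zero]; exact Subsingleton.elim _ _⟩
  obtain ⟨y, hy⟩ := (ZMod.exists_sq_eq_neg_one_iff (p := q)).2 (by omega)
  obtain ⟨z, rfl⟩ := ZMod.intCast_surjective y
  have h1 : (q : ℤ) ∣ z * z - (-1) := by
    rw [← ZMod.intCast_zmod_eq_zero_iff_dvd]
    push_cast
    rw [← hy]
    ring
  have h2 := dvd_sub_pow_of_dvd_sub h1 m
  have hodd : Odd (q ^ m) := (Nat.odd_iff.2 (by omega)).pow
  rw [hodd.neg_one_pow] at h2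
  refine ⟨((z ^ q ^ m : ℤ) : ZMod (q ^ (m + 1))), ?_⟩
  have h3 : (((z * z) ^ q ^ m - (-1) : ℤ) : ZMod (q ^ (m + 1))) = 0 := by
    rw [ZMod.intCast_zmod_eq_zero_iff_dvd]
    exact_mod_cast h2
  push_cast at h3 ⊢
  rw [← mul_pow]
  linear_combination -h3

theorem isSquare_neg_one_of_primes (n : ℕ) (h0 : n ≠ 0) (h4 : ¬ 4 ∣ n)
    (hn : ∀ q : ℕ, q.Prime → q ∣ n → q = 2 ∨ q % 4 = 1) : IsSquare (-1 : ZMod n) := by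
  induction n using Nat.recOnPosPrimePosCoprime with
  | zero => exact absurd rfl h0
  | one => exact ⟨0, Subsingleton.elim _ _⟩
  | prime_pow q m hq hm =>
    rcases hn q hq (dvd_pow_self q hm.ne') with rfl | h
    · have hm1 : m = 1 := by
        by_contra hne
        exact h4 (pow_dvd_pow 2 (show 2 ≤ m by omega))
      subst hm1
      exact ⟨1, by decide⟩
    · exact isSquare_neg_one_of_prime_pow hq h m
  | coprime a b ha hb hab iha ihb =>
    exact ZMod.isSquare_neg_one_mul hab
      (iha (by omega) (fun h => h4 (h.mul_right b)) fun q hq h => hn q hq (h.mul_right b))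
      (ihb (by omega) (fun h => h4 (h.mul_left a)) fun q hq h => hn q hq (h.mul_left a))

/-- If `n > 1` is not divisible by `4` and all its odd prime factors are `1` modulo `4`, then `a` and
`b` are adjacent exactly when `a - b` is the square of a unit. -/
theorem paleyTypeGraph_adj_iff {n : ℕ} (h1 : 1 < n) (h4 : ¬ 4 ∣ n)
    (hn : ∀ q : ℕ, q.Prime → q ∣ n → q = 2 ∨ q % 4 = 1) (a b : ZMod n) :
    (paleyTypeGraph n).Adj a b ↔ ∃ u : (ZMod n)ˣ, a - b = (u : ZMod n) ^ 2 := by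
  haveI := Fact.mk h1
  obtain ⟨i, hi⟩ := isSquare_neg_one_of_primes n (by omega) h4 hn
  have hu : i * (-i) = 1 := by linear_combination hi
  rw [paleyTypeGraph, SimpleGraph.fromRel_adj]
  constructor
  · rintro ⟨-, h | ⟨u, h⟩⟩
    · exact h
    · refine ⟨u * ⟨i, -i, hu, by rw [mul_comm]; exact hu⟩, ?_⟩
      push_cast
      rw [mul_pow, ← h]
      linear_combination (b - a) * hi
  · rintro ⟨u, h⟩
    refine ⟨?_, Or.inl ⟨u, h⟩⟩
    rintro rfl
    rw [sub_self] at h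
    exact (u ^ 2).ne_zero (by push_cast; exact h.symm)

/-!
A ring homomorphism maps unit squares to unit squares, so for a prime `q ∣ n` reduction modulo `q`
maps the cliques of the Paley-type graph of order `n` injectively to cliques over `ZMod q`. By
Fermat's little theorem the differences in a clique over `ZMod q` all satisfy `x ^ (q / 2) = 1`
(`pow_half_sub_eq_one_of_adj`). After translating one vertex to `0`, a finite check shows that three
vertices are impossible for `q = 5`, and four are impossible for `q = 13` and `q = 17`.

Conversely, `{0, 1}` is always an edge, and the Pythagorean triple `3² + 4² = 5²` makes
`{0, 3², 5²}` a triangle as soon as `2`, `3` and `5` are units modulo `n`.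
-/

/-- Adjacent vertices of the Paley-type graph differ, modulo a prime `q ≡ 1 (mod 4)` dividing the
order, by an element that satisfies Euler's criterion. The congruence makes `q / 2` even, so that the
order of the two vertices is irrelevant. -/
theorem pow_half_sub_eq_one_of_adj {n q : ℕ} (hq : q.Prime) (h4 : q % 4 = 1) (hqn : q ∣ n)
    {a b : ZMod n} (h : (paleyTypeGraph n).Adj a b) :
    (ZMod.castHom hqn (ZMod q) a - ZMod.castHom hqn (ZMod q) b) ^ (q / 2) = 1 := by
  have := Fact.mk hq
  have key : ∀ c d : ZMod n, (∃ u : (ZMod n)ˣ, c - d = (u : ZMod n) ^ 2) →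
      (ZMod.castHom hqn (ZMod q) c - ZMod.castHom hqn (ZMod q) d) ^ (q / 2) = 1 := by
    rintro c d ⟨u, hu⟩
    rw [← map_sub, hu, map_pow, ← pow_mul, show 2 * (q / 2) = q - 1 by omega]
    exact ZMod.pow_card_sub_one_eq_one (u.isUnit.map (ZMod.castHom hqn (ZMod q))).ne_zero
  rw [paleyTypeGraph, SimpleGraph.fromRel_adj] at h
  rcases h.2 with h | h
  · exact key a b h
  · have heven : Even (q / 2) := Nat.even_iff.2 (by omega)
    rw [← heven.neg_pow, neg_sub]
    exact key b a h

theorem paleyTypeGraph_cliqueFree_three {n : ℕ} (h : 5 ∣ n) :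
    (paleyTypeGraph n).CliqueFree 3 := by
  by_contra hc
  obtain ⟨f⟩ := (SimpleGraph.not_cliqueFree_iff_top_isContained 3).1 hc
  have hf : ∀ i j : Fin 3, i ≠ j →
      (ZMod.castHom h (ZMod 5) (f i) - ZMod.castHom h (ZMod 5) (f j)) ^ 2 = 1 := fun i j hij =>
    pow_half_sub_eq_one_of_adj (by norm_num) rfl h (f.toHom.map_adj hij)
  have key : ∀ x y : ZMod 5, x ^ 2 = 1 → y ^ 2 = 1 → (x - y) ^ 2 ≠ 1 := by decide
  refine key _ _ (hf 1 0 (by decide)) (hf 2 0 (by decide)) ?_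
  rw [sub_sub_sub_cancel_right]
  exact hf 1 2 (by decide)

/-- If no three elements `x, y, z` of `ZMod q`, together with their differences, all satisfy Euler's
criterion, then there is no `4`-clique: translate one of its vertices to `0`. -/
theorem paleyTypeGraph_cliqueFree_four {n q : ℕ} (hq : q.Prime) (h4 : q % 4 = 1) (hqn : q ∣ n)
    (key : ∀ x : ZMod q, x ^ (q / 2) = 1 → ∀ y : ZMod q, y ^ (q / 2) = 1 →
      (x - y) ^ (q / 2) = 1 → ∀ z : ZMod q, z ^ (q / 2) = 1 → (x - z) ^ (q / 2) = 1 →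
      (y - z) ^ (q / 2) ≠ 1) :
    (paleyTypeGraph n).CliqueFree 4 := by
  by_contra hc
  obtain ⟨f⟩ := (SimpleGraph.not_cliqueFree_iff_top_isContained 4).1 hc
  have hf : ∀ i j : Fin 4, i ≠ j →
      (ZMod.castHom hqn (ZMod q) (f i) - ZMod.castHom hqn (ZMod q) (f j)) ^ (q / 2) = 1 :=
    fun i j hij => pow_half_sub_eq_one_of_adj hq h4 hqn (f.toHom.map_adj hij)
  refine key _ (hf 1 0 (by decide)) _ (hf 2 0 (by decide)) ?_ _ (hf 3 0 (by decide)) ?_ ?_ <;>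
    rw [sub_sub_sub_cancel_right]
  · exact hf 1 2 (by decide)
  · exact hf 1 3 (by decide)
  · exact hf 2 3 (by decide)

theorem SimpleGraph.CliqueFree.cliqueNum_lt {V : Type*} [Finite V] {G : SimpleGraph V} {m : ℕ}
    (h : G.CliqueFree m) : G.cliqueNum < m := by
  obtain ⟨s, hs⟩ := G.exists_isNClique_cliqueNum
  by_contra! hle
  exact h.mono hle s hs

theorem paleyTypeGraph_adj_of_sub_eq_sq {n : ℕ} (h1 : 1 < n) {a b : ZMod n} {u : ZMod n}
    (hu : IsUnit u) (h : a - b = u ^ 2) : (paleyTypeGraph n).Adj a b := by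
  have := Fact.mk h1
  obtain ⟨u, rfl⟩ := hu
  rw [paleyTypeGraph, SimpleGraph.fromRel_adj]
  refine ⟨?_, Or.inl ⟨u, h⟩⟩
  rintro rfl
  exact (u ^ 2).ne_zero (by rw [Units.val_pow_eq_pow_val, ← h, sub_self])

theorem two_le_cliqueNum_paleyTypeGraph {n : ℕ} (h1 : 1 < n) :
    2 ≤ (paleyTypeGraph n).cliqueNum := by
  have : NeZero n := ⟨by omega⟩
  have h : (paleyTypeGraph n).Adj 1 0 :=
    paleyTypeGraph_adj_of_sub_eq_sq h1 isUnit_one (by ring)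
  have hc : (paleyTypeGraph n).IsClique (({1, 0} : Finset (ZMod n)) : Set (ZMod n)) := by
    rw [Finset.coe_pair]
    exact SimpleGraph.isClique_pair.2 fun _ => h
  calc 2 = ({1, 0} : Finset (ZMod n)).card := (Finset.card_pair h.ne).symm
    _ ≤ _ := hc.card_le_cliqueNum

/-- The triangle is `{0, 3², 5²}`. -/
theorem three_le_cliqueNum_paleyTypeGraph {n : ℕ} (h1 : 1 < n) (hn : n.Coprime 30) :
    3 ≤ (paleyTypeGraph n).cliqueNum := by
  have : NeZero n := ⟨by omega⟩
  have hunit : ∀ m : ℕ, m.Coprime n → IsUnit (m : ZMod n) := fun m hm =>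
    (ZMod.isUnit_iff_coprime m n).2 hm
  have h2 : Nat.Coprime 2 n := (hn.coprime_dvd_right (by norm_num)).symm
  have h3 : Nat.Coprime 3 n := (hn.coprime_dvd_right (by norm_num)).symm
  have h4 : Nat.Coprime 4 n := h2.pow_left 2
  have h5 : Nat.Coprime 5 n := (hn.coprime_dvd_right (by norm_num)).symm
  have hc : (paleyTypeGraph n).IsNClique 3 {25, 9, 0} := by
    rw [SimpleGraph.is3Clique_triple_iff]
    refine ⟨paleyTypeGraph_adj_of_sub_eq_sq h1 (hunit 4 h4) ?_,
      paleyTypeGraph_adj_of_sub_eq_sq h1 (hunit 5 h5) ?_,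
      paleyTypeGraph_adj_of_sub_eq_sq h1 (hunit 3 h3) ?_⟩ <;> push_cast <;> ring
  rw [← hc.card_eq]
  exact hc.isClique.card_le_cliqueNum

theorem mainTheorem6 (k : ℕ) (p α : Fin k → ℕ)
    (hp : ∀ i, (p i).Prime) (hdistinct : Function.Injective p)
    (hmod : ∀ i, p i % 4 = 1) (hα : ∀ i, 1 ≤ α i)
    (n : ℕ) (hn : n = ∏ i, p i ^ α i) :
    ((∃ i, p i = 5) → (paleyTypeGraph n).cliqueNum = 2) ∧
    ((∃ i, p i = 13 ∨ p i = 17) → ¬ 5 ∣ n → (paleyTypeGraph n).cliqueNum = 3) := by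
  have hdvd : ∀ i, p i ∣ n := fun i => by
    rw [hn]
    exact (dvd_pow_self _ (by have := hα i; omega)).trans
      (Finset.dvd_prod_of_mem _ (Finset.mem_univ i))
  have hpos : 0 < n := by
    rw [hn]
    exact Finset.prod_pos fun i _ => pow_pos (hp i).pos _
  have : NeZero n := ⟨hpos.ne'⟩
  have hone : ∀ i, 1 < n := fun i => (hp i).one_lt.trans_le (Nat.le_of_dvd hpos (hdvd i))
  have hprime : ∀ q : ℕ, q.Prime → q ∣ n → q % 4 = 1 := fun q hq h => by
    rw [hn] at h
    obtain ⟨i, -, hi⟩ := (hq.prime.dvd_finsetProd_iff _).1 h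
    rw [(Nat.prime_dvd_prime_iff_eq hq (hp i)).1 (hq.dvd_of_dvd_pow hi)]
    exact hmod i
  constructor
  · rintro ⟨i, hi⟩
    have := (paleyTypeGraph_cliqueFree_three (hi ▸ hdvd i)).cliqueNum_lt
    have := two_le_cliqueNum_paleyTypeGraph (hone i)
    omega
  · rintro ⟨i, hi⟩ h5
    have hfree : (paleyTypeGraph n).CliqueFree 4 := by
      rcases hi with hi | hi
      · exact paleyTypeGraph_cliqueFree_four (q := 13) (by norm_num) rfl (hi ▸ hdvd i)
          (by decide +kernel)
      · exact paleyTypeGraph_cliqueFree_four (q := 17) (by norm_num) rfl (hi ▸ hdvd i)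
          (by decide +kernel)
    have hcop : n.Coprime 30 := by
      have hc : ∀ q : ℕ, q.Prime → ¬ q ∣ n → n.Coprime q := fun q hq h =>
        ((Nat.Prime.coprime_iff_not_dvd hq).2 h).symm
      have h2 := hc 2 Nat.prime_two fun h => absurd (hprime 2 Nat.prime_two h) (by norm_num)
      have h3 := hc 3 Nat.prime_three fun h => absurd (hprime 3 Nat.prime_three h) (by norm_num)
      exact (h2.mul_right h3).mul_right (hc 5 Nat.prime_five h5)
    have := hfree.cliqueNum_lt
    have := three_le_cliqueNum_paleyTypeGraph (hone i) hcop
    omega
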